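/- Let $A$ be a finite local ring with $1\neq 0$, not necessarily commutative, with Jacobson radical $\mathfrak r$ and residue field $A/\mathfrak r\cong F_q$ of odd characteristic. Suppose $A$ has an involution $*$ (an additive map with $1^*=1$, $(ab)^*=b^*a^*$ and $a^{**}=a$) such that $a-a^*\in\mathfrak r$ for all $a\in A$. Let $\mathfrak m$ be the additive group of all $a\in\mathfrak r$ with $a^*=a$. For an integer $m\geq 0$, let $$J=\begin{pmatrix}0&1\\-1&0\end{pmatrix}$$ with blocks of size $m\times m$, and let $U_{2m}(A)$ be the group of all $X\in \mathrm{GL}_{2m}(A)$ with $X^*JX=J$, where $(X^*)_{ij}=(X_{ji})^*$. Then $$|U_{2m}(A)|=|\mathfrak r|^{2m^2-m}\,|\mathfrak m|^{2m}\,q^{m^2}(q^{2m}-1)(q^{2(m-1)}-1)\cdots(q^2-1)=|\mathfrak r|^{2m^2-m}\,|\mathfrak m|^{2m}\,|\mathrm{Sp}_{2m}(q)|,$$ where $|\mathrm{Sp}_{2m}(q)|=q^{m^2}(q^{2m}-1)(q^{2(m-1)}-1)\cdots(q^2-1)$ is the order of the symplectic group over $F_q$. Moreover, $|U(V,h)|$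 is given by the same formula for every free right $A$-module $V$ of rank $2m$ and every non-degenerate skew-hermitian form $h$ on $V$. Here a skew-hermitian form is a map $h:V\times V\to A$ that is $A$-linear in the second variable and satisfies $h(v,u)=-h(u,v)^*$ for all $u,v\in V$; it is non-degenerate if $v\mapsto h(v,-)$ is a bijection from $V$ onto its dual $\mathrm{Hom}_A(V,A)$; and $U(V,h)$ is the group of all $A$-linear automorphisms $g$ of $V$ with $h(gu,gv)=h(u,v)$ for all $u,v\in V$. -/

import Mathlib

universe u v w

open Matrix MatrixGroups

/-- The block matrix `(0, 1; -1, 0)` of size `2m × 2m`, with blocks of size `m × m`. -/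
def standardSkew (A : Type u) [Ring A] (m : ℕ) : Matrix (Fin m ⊕ Fin m) (Fin m ⊕ Fin m) A :=
  Matrix.fromBlocks 0 1 (-1) 0

/-- The group `U_{2m}(A)` of all invertible `2m × 2m` matrices `X` with `X^* J X = J`, where
`(X^*)_{ij} = (X_{ji})^*` and `J` is `standardSkew A m`. -/
def unitaryMatrixGroup (A : Type u) [Ring A] [StarRing A] (m : ℕ) :
    Subgroup (GL (Fin m ⊕ Fin m) A) where
  carrier := {X | X.valᴴ * standardSkew A m * X.val = standardSkew A m}
  one_mem' := by simp
  mul_mem' := by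
    intro X Y (hX : X.valᴴ * standardSkew A m * X.val = standardSkew A m)
      (hY : Y.valᴴ * standardSkew A m * Y.val = standardSkew A m)
    change (X.val * Y.val)ᴴ * standardSkew A m * (X.val * Y.val) = standardSkew A m
    calc (X.val * Y.val)ᴴ * standardSkew A m * (X.val * Y.val)
        = Y.valᴴ * (X.valᴴ * standardSkew A m * X.val) * Y.val := by
          simp only [Matrix.conjTranspose_mul, Matrix.mul_assoc]
      _ = standardSkew A m := by rw [hX, hY]
  inv_mem' := by
    intro X (hX : X.valᴴ * standardSkew A m * X.val = standardSkew A m)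
    change X⁻¹.valᴴ * standardSkew A m * X⁻¹.val = standardSkew A m
    have h1 : X.val * X⁻¹.val = 1 := X.mul_inv
    have h2 : X⁻¹.valᴴ * X.valᴴ = 1 := by
      rw [← Matrix.conjTranspose_mul, h1, Matrix.conjTranspose_one]
    calc X⁻¹.valᴴ * standardSkew A m * X⁻¹.val
        = X⁻¹.valᴴ * (X.valᴴ * standardSkew A m * X.val) * X⁻¹.val := by rw [hX]
      _ = (X⁻¹.valᴴ * X.valᴴ) * standardSkew A m * (X.val * X⁻¹.val) := by
          simp only [Matrix.mul_assoc]
      _ = standardSkew A m := by rw [h1, h2, Matrix.one_mul, Matrix.mul_one]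

/-- A skew-hermitian form on a right `A`-module `V` (a module over `Aᵐᵒᵖ`): a map
`h : V × V → A`, linear in the second variable, with `h(v, u) = -h(u, v)^*`. The field `form`
is the map `T_h : v ↦ h(v, -)` from `V` to its dual. -/
structure SkewHermitianForm (A : Type u) [Ring A] [StarRing A] (V : Type v) [AddCommGroup V]
    [Module Aᵐᵒᵖ V] where
  form : V → (V →ₗ[Aᵐᵒᵖ] A)
  skew : ∀ u v : V, form v u = -star (form u v)

namespace SkewHermitianForm

variable {A : Type u} [Ring A] [StarRing A] {V : Type v} [AddCommGroup V] [Module Aᵐᵒᵖ V]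

/-- `h` is non-degenerate if `T_h : V → V^*` is an isomorphism. -/
def Nondegenerate (h : SkewHermitianForm A V) : Prop :=
  Function.Bijective h.form

/-- The unitary group `U(V, h)` of all `A`-linear automorphisms of `V` preserving `h`. -/
def unitaryGroup (h : SkewHermitianForm A V) : Subgroup (V ≃ₗ[Aᵐᵒᵖ] V) where
  carrier := {g | ∀ u v : V, h.form (g u) (g v) = h.form u v}
  one_mem' := fun _ _ => rfl
  mul_mem' := by
    intro f g hf hg u v
    exact (hf (g u) (g v)).trans (hg u v)
  inv_mem' := by
    intro g hg u v
    have h1 := hg (g⁻¹ u) (g⁻¹ v)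
    have h2 : ∀ x : V, g (g⁻¹ x) = x := fun x => g.apply_symm_apply x
    rw [h2, h2] at h1
    exact h1.symm

end SkewHermitianForm

/-- The additive group `𝔪` of all hermitian elements of the Jacobson radical of `A`. -/
def hermitianRadical (A : Type u) [Ring A] [StarRing A] : AddSubgroup A :=
  selfAdjoint A ⊓ (Ring.jacobson A).toAddSubgroup

/-! The isometry group acts simply transitively on symplectic frames (families with Gram matrix
`J`), so its order is the number of frames (`card_unitaryGroup`); for the matrix group, the columns
of `X` are the frame. Frames are counted recursively in `card_frames`: a hyperbolic pair, then a
frame of its orthogonal complement. The whole count thus rests on `card_hyperbolic`.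

Let `S` be the group of skew elements. As `2` is invertible and `*` is trivial modulo `𝔯`, `S` lies
in `𝔯` and `𝔯 = 𝔪 ⊕ S`. Each value `h(u, u)` is skew; moving `u` by `x ∈ S` along a vector pairing
to `1` with it modulo `𝔯` changes `h(u, u)` by `2x` plus a perturbation with coefficients in `𝔯`.
Exactly one `x` makes the new value zero (`exists_unique_quadratic`), so a proportion `1/|S|` of the
nonsingular vectors is isotropic.

The recursion carries only two cardinalities, `|V| = |A|^(2m)` and `|singular| = |𝔯|^(2m)`, so the
complement need not be shown free or non-degenerate. The existence of a frame is read off from the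
count being nonzero. -/

/-- An involution on a finite ring with `2` invertible, all of whose elements outside the radical
are units, such that the involution is trivial modulo the radical. -/
structure TrivialModRadical (A : Type u) [Ring A] [StarRing A] : Prop where
  isUnit_two : IsUnit (2 : A)
  isUnit : ∀ a : A, a ∉ Ring.jacobson A → IsUnit a
  sub_star_mem : ∀ a : A, a - star a ∈ Ring.jacobson A

/-! ### Units, nilpotents and the residue field of a finite local ring. -/

/-- Lift the inverse of the residue class to `b`; then `a * b` lies in `1 + 𝔯`, which consists of
units. Finiteness makes one-sided inverses two-sided. -/
theorem isUnit_of_notMem_jacobson {A : Type u} [Ring A] [Finite A] {F : Type w} [Field F]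
    (e : (A ⧸ Ring.jacobson A) ≃+* F) (a : A) (ha : a ∉ Ring.jacobson A) : IsUnit a := by
  have one_add : ∀ x ∈ Ring.jacobson A, IsUnit (1 + x) := by
    intro x hx
    rw [← Ideal.jacobson_bot, Ideal.mem_jacobson_iff] at hx
    obtain ⟨z, hz⟩ := hx 1
    refine .of_mul_eq_one_right z ?_
    have : z * 1 * x + z - 1 = 0 := by simpa using hz
    rw [← sub_eq_zero, ← this]
    noncomm_ring
  have h0 : e (Ideal.Quotient.mk _ a) ≠ 0 := by
    rw [Ne, EmbeddingLike.map_eq_zero_iff, Ideal.Quotient.eq_zero_iff_mem]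
    exact ha
  obtain ⟨b, hb⟩ := Ideal.Quotient.mk_surjective (e.symm (e (Ideal.Quotient.mk _ a))⁻¹)
  have h1 : a * b - 1 ∈ Ring.jacobson A := by
    rw [← Ideal.Quotient.eq_zero_iff_mem, map_sub, map_mul, hb, map_one, sub_eq_zero]
    apply e.injective
    simp [h0]
  obtain ⟨c, hc⟩ := (one_add _ h1).exists_right_inv
  refine .of_mul_eq_one (b * c) ?_
  rw [← mul_assoc]
  simpa using hc

theorem isUnit_two_of_odd_ringChar {A : Type u} [Ring A] [Finite A] {F : Type w} [Field F]
    (e : (A ⧸ Ring.jacobson A) ≃+* F) (hchar : Odd (ringChar F)) : IsUnit (2 : A) := by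
  apply isUnit_of_notMem_jacobson e
  intro h
  have h2 : ((2 : ℕ) : F) = 0 := by
    have : e (Ideal.Quotient.mk _ (2 : A)) = 0 := by
      rw [Ideal.Quotient.eq_zero_iff_mem.mpr h, map_zero]
    rwa [map_ofNat, map_ofNat] at this
  have h3 := (ringChar.spec F 2).mp h2
  have h4 : ringChar F ≠ 1 := CharP.ringChar_ne_one
  rcases (Nat.dvd_prime Nat.prime_two).mp h3 with h5 | h5
  · exact h4 h5
  · rw [h5] at hchar
    exact absurd hchar (by decide)

theorem isNilpotent_of_mem_jacobson {A : Type u} [Ring A] [Finite A] {a : A}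
    (ha : a ∈ Ring.jacobson A) : IsNilpotent a := by
  obtain ⟨n, hn⟩ := IsArtinianRing.isNilpotent_jacobson_bot (R := A)
  rw [Ideal.jacobson_bot] at hn
  have := Ideal.pow_mem_pow ha n
  rw [hn] at this
  exact ⟨n, by simpa using this⟩

theorem card_eq_card_residue_mul {A : Type u} [Ring A] {F : Type w} [Field F]
    (e : (A ⧸ Ring.jacobson A) ≃+* F) :
    Nat.card A = Nat.card F * Nat.card (Ring.jacobson A) := by
  rw [← Nat.card_congr e.toEquiv]
  rw [mul_comm]
  exact Submodule.card_eq_card_quotient_mul_card (Ring.jacobson A)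

/-! ### Skew elements and the quadratic equation over them. -/

namespace TrivialModRadical

variable {A : Type u} [Ring A] [StarRing A] (hA : TrivialModRadical A)
include hA

theorem star_mem {a : A} (ha : a ∈ Ring.jacobson A) : star a ∈ Ring.jacobson A := by
  simpa using sub_mem ha (hA.sub_star_mem a)

theorem star_mem_iff {a : A} : star a ∈ Ring.jacobson A ↔ a ∈ Ring.jacobson A :=
  ⟨fun h => by simpa using hA.star_mem h, hA.star_mem⟩

/-- For skew `a`, `2 * a = a - star a`. -/
theorem skew_mem {a : A} (ha : star a = -a) : a ∈ Ring.jacobson A := by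
  obtain ⟨t, ht⟩ := hA.isUnit_two.exists_left_inv
  have h := hA.sub_star_mem a
  rw [ha, sub_neg_eq_add, ← two_mul] at h
  have := Ideal.mul_mem_left _ t h
  rwa [← mul_assoc, ht, one_mul] at this

theorem two_mul_cancel {a b : A} (h : 2 * a = 2 * b) : a = b :=
  hA.isUnit_two.mul_left_cancel h

/-- The map `x ↦ bx + xb^* - xcx` is injective on skew elements if `b ≡ 1` and `c ≡ 0`. -/
theorem quadratic_injOn [Finite A] {b b' c x y : A} (hb : b - 1 ∈ Ring.jacobson A)
    (hb' : b' - 1 ∈ Ring.jacobson A) (hc : c ∈ Ring.jacobson A)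
    (h : b * x + x * b' - x * c * x = b * y + y * b' - y * c * y) : x = y := by
  have hp : b - 1 - y * c ∈ Ring.jacobson A := sub_mem hb (Ideal.mul_mem_left _ _ hc)
  have hq : b' - 1 - c * x ∈ Ring.jacobson A := sub_mem hb' (Ideal.mul_mem_right _ _ hc)
  -- The difference of the two sides is `2d + pd + dq` with `d = x - y` and `p`, `q` in the radical.
  -- Left and right multiplications commute, so `d ↦ pd + dq` is nilpotent and `d ↦ 2d + pd + dq` is
  -- invertible.
  have key : ∀ d : A, 2 * d + ((b - 1 - y * c) * d + d * (b' - 1 - c * x)) = 0 → d = 0 := by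
    intro d hd
    have n1 := (LinearMap.isNilpotent_mulLeft_iff ℤ (b - 1 - y * c)).mpr
      (isNilpotent_of_mem_jacobson hp)
    have n2 := (LinearMap.isNilpotent_mulRight_iff ℤ (b' - 1 - c * x)).mpr
      (isNilpotent_of_mem_jacobson hq)
    have n3 := (LinearMap.commute_mulLeft_right (R := ℤ) (b - 1 - y * c)
      (b' - 1 - c * x)).isNilpotent_add n1 n2
    have u2 : IsUnit (LinearMap.mulLeft ℤ (2 : A)) := by
      obtain ⟨t, ht⟩ := hA.isUnit_two
      refine ⟨⟨LinearMap.mulLeft ℤ (t : A), LinearMap.mulLeft ℤ ((t⁻¹ : Aˣ) : A), ?_, ?_⟩, ?_⟩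
      · ext a; simp
      · ext a; simp
      · simp [ht]
    have u3 := n3.isUnit_add_left_of_commute u2 (by
      ext a
      simp [mul_add, two_mul, add_mul])
    have := ((Module.End.isUnit_iff _).mp u3).1
    apply this
    simpa using hd
  rw [← sub_eq_zero]
  apply key
  have : 2 * (x - y) + ((b - 1 - y * c) * (x - y) + (x - y) * (b' - 1 - c * x)) =
      (b * x + x * b' - x * c * x) - (b * y + y * b' - y * c * y) := by noncomm_ring
  rw [this, h, sub_self]

/-- The quadratic map sends the finite set of skew elements to itself, so its injectivity already
gives surjectivity. -/
theorem exists_unique_quadratic [Finite A] {b c s : A} (hb : b - 1 ∈ Ring.jacobson A)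
    (hc : star c = -c) (hs : star s = -s) :
    ∃! x : skewAdjoint A, s + (b * x + x * star b - x * c * x) = 0 := by
  have hb' : star b - 1 ∈ Ring.jacobson A := by simpa using hA.star_mem hb
  let f : skewAdjoint A → skewAdjoint A := fun x =>
    ⟨-(b * x + x * star b - x * c * x), by
      have := skewAdjoint.mem_iff.mp x.2
      rw [skewAdjoint.mem_iff]
      simp [this, hc]
      noncomm_ring⟩
  have hf : Function.Bijective f := by
    rw [← Finite.injective_iff_bijective]
    intro x y hxy
    exact Subtype.ext (hA.quadratic_injOn hb hb' (hA.skew_mem hc)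
      (neg_injective (congrArg Subtype.val hxy)))
  obtain ⟨x, hx, hu⟩ := (Function.bijective_iff_existsUnique f).mp hf ⟨s, skewAdjoint.mem_iff.mpr hs⟩
  refine ⟨x, ?_, fun y hy => hu y (Subtype.ext ?_)⟩
  · change s + _ = 0
    have h1 : f x = s := congrArg Subtype.val hx
    rw [← h1]
    simp [f]
  · exact (eq_neg_of_add_eq_zero_left hy).symm

/-- Every `x` in `𝔯` splits uniquely as `(x + x^*)/2 + (x - x^*)/2`, and all skew elements lie in
`𝔯`. -/
theorem card_jacobson [Finite A] : Nat.card (Ring.jacobson A) =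
    Nat.card (hermitianRadical A) * Nat.card (skewAdjoint A) := by
  rw [← Nat.card_prod]
  refine (Nat.card_congr (Equiv.ofBijective (fun p => ⟨p.1.1 + p.2.1,
    add_mem p.1.2.2 (hA.skew_mem (skewAdjoint.mem_iff.mp p.2.2))⟩) ⟨?_, ?_⟩)).symm
  · rintro ⟨⟨a, ha⟩, ⟨b, hb⟩⟩ ⟨⟨a', ha'⟩, ⟨b', hb'⟩⟩ h
    have h1 : a + b = a' + b' := congrArg Subtype.val h
    have h2 := congrArg star h1
    rw [star_add, star_add, selfAdjoint.mem_iff.mp ha.1, selfAdjoint.mem_iff.mp ha'.1,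
      skewAdjoint.mem_iff.mp hb, skewAdjoint.mem_iff.mp hb'] at h2
    have h3 : a = a' := by
      apply hA.two_mul_cancel
      have h4 : ∀ u v : A, 2 * u = (u + v) + (u + -v) := fun u v => by noncomm_ring
      rw [h4 a b, h4 a' b', h1, h2]
    subst h3
    have h4 : b = b' := add_left_cancel h1
    subst h4
    rfl
  · rintro ⟨x, hx⟩
    obtain ⟨t, ht⟩ := hA.isUnit_two
    have ht2 : ∀ y : A, (t⁻¹ : Aˣ) * (2 * y) = y := fun y => by rw [← ht]; simp
    have h2t : ∀ y : A, 2 * ((t⁻¹ : Aˣ) * y) = y := fun y => by rw [← ht]; simp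
    have hst : ∀ y : A, star ((t⁻¹ : Aˣ) * y) = (t⁻¹ : Aˣ) * star y := by
      intro y
      apply hA.two_mul_cancel
      rw [h2t]
      conv_rhs => rw [← h2t y]
      rw [two_mul, two_mul, star_add]
    have hsx := hA.star_mem hx
    refine ⟨⟨⟨(t⁻¹ : Aˣ) * (x + star x), ?_, Ideal.mul_mem_left _ _ (add_mem hx hsx)⟩,
      ⟨(t⁻¹ : Aˣ) * (x - star x), ?_⟩⟩, ?_⟩
    · exact selfAdjoint.mem_iff.mpr (by rw [hst]; simp [add_comm])
    · exact skewAdjoint.mem_iff.mpr (by rw [hst, star_sub, star_star, ← mul_neg, neg_sub])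
    · refine Subtype.ext ?_
      change (t⁻¹ : Aˣ) * (x + star x) + (t⁻¹ : Aˣ) * (x - star x) = x
      rw [← mul_add, add_add_sub_cancel, ← two_mul, ht2]

end TrivialModRadical

/-! ### Counting vectors by translation. -/

/-- Each `c` is recovered from its unique good translate and the parameter used. Only reversibility
of each move is required, not additivity, since the direction of translation may depend on `c`. -/
theorem card_eq_card_mul_card_of_existsUnique {C : Type*} {K : Type*} [AddGroup K]
    (act : C → K → C) (hact : ∀ c x, act (act c x) (-x) = c) (P : C → Prop)
    (hP : ∀ c, ∃! x, P (act c x)) : Nat.card C = Nat.card K * Nat.card {c // P c} := by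
  choose x hx hu using hP
  rw [← Nat.card_prod]
  refine Nat.card_congr ⟨fun c => (x c, ⟨act c (x c), hx c⟩), fun p => act p.2.1 (-p.1),
    fun c => hact c _, ?_⟩
  rintro ⟨y, d, hd⟩
  have h1 : act (act d (-y)) y = d := by simpa using hact d (-y)
  have h2 : x (act d (-y)) = y := (hu _ y (by simpa only [h1] using hd)).symm
  simp only [h2, h1]

namespace SkewHermitianForm

open MulOpposite

variable {A : Type u} [Ring A] [StarRing A] {V : Type v} [AddCommGroup V] [Module Aᵐᵒᵖ V]
  (h : SkewHermitianForm A V)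

theorem form_smul_right (u v : V) (a : A) : h.form u (op a • v) = h.form u v * a := by
  rw [map_smul, op_smul_eq_mul]

theorem form_add_left (u u' v : V) : h.form (u + u') v = h.form u v + h.form u' v := by
  rw [h.skew v, h.skew v u, h.skew v u', map_add, star_add, neg_add]

theorem form_zero_left (v : V) : h.form 0 v = 0 := by
  rw [h.skew v, map_zero, star_zero, neg_zero]

theorem form_neg_left (u v : V) : h.form (-u) v = -h.form u v := by
  rw [h.skew v, h.skew v u, map_neg, star_neg]

theorem form_smul_left (u v : V) (a : A) : h.form (op a • u) v = star a * h.form u v := by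
  rw [h.skew v, h.skew v u, form_smul_right, star_mul, mul_neg]

theorem star_form_self (u : V) : star (h.form u u) = -h.form u u := by
  rw [eq_comm, neg_eq_iff_eq_neg]
  exact h.skew u u

theorem form_add_smul_self (u w : V) (x : A) :
    h.form (u + op x • w) (u + op x • w) = h.form u u + (h.form u w * x -
      star x * star (h.form u w) + star x * h.form w w * x) := by
  simp only [form_add_left, form_smul_left, form_smul_right, map_add]
  rw [h.skew u w]
  noncomm_ring

/-- The vectors whose pairing with every vector lies in the radical. -/
def singular : AddSubgroup V where
  carrier := {u | ∀ w, h.form u w ∈ Ring.jacobson A}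
  zero_mem' := fun w => by rw [form_zero_left]; exact zero_mem _
  add_mem' := fun ha hb w => by rw [form_add_left]; exact add_mem (ha w) (hb w)
  neg_mem' := fun ha w => by rw [form_neg_left]; exact neg_mem (ha w)

theorem mem_singular {u : V} : u ∈ h.singular ↔ ∀ w, h.form u w ∈ Ring.jacobson A := Iff.rfl

variable {h} (hA : TrivialModRadical A)
include hA

theorem smul_mem_singular {x : A} (hx : x ∈ Ring.jacobson A) (w : V) :
    op x • w ∈ h.singular := fun v => by
  rw [form_smul_left]
  exact Ideal.mul_mem_right _ _ (hA.star_mem hx)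

theorem exists_form_eq_one {u : V} (hu : u ∉ h.singular) : ∃ w, h.form u w = 1 := by
  simp only [mem_singular, not_forall] at hu
  obtain ⟨w, hw⟩ := hu
  obtain ⟨b, hb⟩ := (hA.isUnit _ hw).exists_right_inv
  exact ⟨op b • w, by rw [form_smul_right, hb]⟩

theorem card_nonsingular [Finite A] :
    Nat.card {u : V // u ∉ h.singular} = Nat.card (skewAdjoint A) *
      Nat.card {u : {u : V // u ∉ h.singular} // h.form u.1 u.1 = 0} := by
  -- The direction `w` depends only on the class of `u` modulo singular vectors. Adding `w x` with
  -- `x` skew, hence in `𝔯`, keeps that class, so translating by `-x` undoes the move.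
  have hω : ∀ z : V ⧸ h.singular, ∃ w : V, z ≠ 0 → ∀ u : V, (u : V ⧸ h.singular) = z →
      h.form u w - 1 ∈ Ring.jacobson A := by
    intro z
    obtain ⟨u₀, rfl⟩ := QuotientAddGroup.mk_surjective z
    by_cases hz : u₀ ∈ h.singular
    · exact ⟨0, fun h0 => absurd ((QuotientAddGroup.eq_zero_iff u₀).mpr hz) h0⟩
    · obtain ⟨w, hw⟩ := exists_form_eq_one hA hz
      refine ⟨w, fun _ u hu => ?_⟩
      have := QuotientAddGroup.eq.mp hu.symm w
      rwa [form_add_left, form_neg_left, hw, neg_add_eq_sub] at this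
  choose ω hω using hω
  have hmk : ∀ (u : V) (x : skewAdjoint A),
      ((u + op (x : A) • ω u : V) : V ⧸ h.singular) = u := fun u x => by
    rw [QuotientAddGroup.mk_add, (QuotientAddGroup.eq_zero_iff _).mpr (smul_mem_singular hA
      (hA.skew_mem (skewAdjoint.mem_iff.mp x.2)) _), add_zero]
  have hns : ∀ (u : {u : V // u ∉ h.singular}) (x : skewAdjoint A),
      u.1 + op (x : A) • ω u.1 ∉ h.singular := fun u x => by
    rw [← QuotientAddGroup.eq_zero_iff, hmk, QuotientAddGroup.eq_zero_iff]
    exact u.2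
  refine card_eq_card_mul_card_of_existsUnique
    (fun u x => ⟨u.1 + op (x : A) • ω u.1, hns u x⟩) ?_ _ ?_
  · rintro ⟨u, hu⟩ x
    refine Subtype.ext ?_
    simp only [hmk]
    simp
  · rintro ⟨u, hu⟩
    have h1 := hω u (by rwa [Ne, QuotientAddGroup.eq_zero_iff]) u rfl
    convert hA.exists_unique_quadratic h1 (h.star_form_self (ω u)) (h.star_form_self u) using 2
      with x
    rw [form_add_smul_self, skewAdjoint.mem_iff.mp x.2]
    noncomm_ring

theorem card_form_eq_one {u : V} (hu : u ∉ h.singular) :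
    Nat.card V = Nat.card A * Nat.card {v : V // h.form u v = 1} := by
  obtain ⟨w, hw⟩ := exists_form_eq_one hA hu
  refine card_eq_card_mul_card_of_existsUnique (fun v x => v + op x • w) ?_ _ ?_
  · intro v x
    simp
  · intro v
    refine ⟨1 - h.form u v, ?_, fun x hx => ?_⟩
    · simp [hw]
    · change h.form u (v + op x • w) = 1 at hx
      rw [map_add, form_smul_right, hw, one_mul] at hx
      exact eq_sub_of_add_eq' hx

/-- Translating `v` along the isotropic `u` keeps `h(u, v) = 1`; with the sign of `x` reversed,
`h(v, v)` changes by exactly `2x`. -/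
theorem card_isotropic_form_eq_one [Finite A] {u : V} (hu : h.form u u = 0) :
    Nat.card {v : V // h.form u v = 1} = Nat.card (skewAdjoint A) *
      Nat.card {v : {v : V // h.form u v = 1} // h.form v.1 v.1 = 0} := by
  have hone : ∀ (v : {v : V // h.form u v = 1}) (x : skewAdjoint A),
      h.form u (v.1 + op (-(x : A)) • u) = 1 := fun v x => by
    rw [map_add, form_smul_right, hu, zero_mul, add_zero, v.2]
  refine card_eq_card_mul_card_of_existsUnique
    (fun v x => ⟨v.1 + op (-(x : A)) • u, hone v x⟩) ?_ _ ?_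
  · rintro ⟨v, hv⟩ x
    refine Subtype.ext ?_
    simp
  · rintro ⟨v, hv⟩
    convert hA.exists_unique_quadratic (b := 1) (c := 0) (by simp) (by simp)
      (h.star_form_self v) using 2 with x
    rw [form_add_smul_self, hu, h.skew u v, hv, star_neg, skewAdjoint.mem_iff.mp x.2]
    simp

end SkewHermitianForm

/-! ### Hyperbolic splitting and the number of frames. -/

namespace SkewHermitianForm

open MulOpposite

variable {A : Type u} [Ring A] [StarRing A] {V : Type v} [AddCommGroup V] [Module Aᵐᵒᵖ V]
  (h : SkewHermitianForm A V)

/-- The restriction of a skew-hermitian form to a submodule. -/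
def restrict (W : Submodule Aᵐᵒᵖ V) : SkewHermitianForm A W where
  form w := (h.form w).domRestrict W
  skew u v := h.skew u v

/-- The orthogonal complement of a pair of vectors. -/
def perp (e f : V) : Submodule Aᵐᵒᵖ V := LinearMap.ker (h.form e) ⊓ LinearMap.ker (h.form f)

theorem mem_perp {e f v : V} : v ∈ h.perp e f ↔ h.form e v = 0 ∧ h.form f v = 0 := Iff.rfl

/-- A hyperbolic pair: two isotropic vectors whose pairing is `1`. -/
structure IsHyperbolic (e f : V) : Prop where
  left : h.form e e = 0
  right : h.form f f = 0
  one : h.form e f = 1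

variable {h}

theorem IsHyperbolic.neg_one {e f : V} (H : h.IsHyperbolic e f) : h.form f e = -1 := by
  rw [h.skew e f, H.one, star_one]

theorem form_eq_zero_comm {u v : V} (H : h.form u v = 0) : h.form v u = 0 := by
  rw [h.skew u v, H, star_zero, neg_zero]

/-- A hyperbolic pair splits off from the space. -/
def IsHyperbolic.decomp {e f : V} (H : h.IsHyperbolic e f) : V ≃ A × A × h.perp e f where
  toFun v := (-h.form f v, h.form e v, ⟨v + op (h.form f v) • e - op (h.form e v) • f, by
    rw [mem_perp]
    simp only [map_add, map_sub, form_smul_right, H.left, H.right, H.one, H.neg_one]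
    simp⟩)
  invFun p := op p.1 • e + op p.2.1 • f + p.2.2
  left_inv v := by
    simp
  right_inv := by
    rintro ⟨a, b, w, hw⟩
    obtain ⟨h1, h2⟩ := h.mem_perp.mp hw
    have h3 : h.form f (op a • e + op b • f + w) = -a := by
      simp only [map_add, form_smul_right, H.right, H.neg_one, h2]
      simp
    have h4 : h.form e (op a • e + op b • f + w) = b := by
      simp only [map_add, form_smul_right, H.left, H.one, h1]
      simp
    simp only [h3, h4, neg_neg, op_neg, neg_smul, Prod.mk.injEq, true_and]
    refine Subtype.ext ?_
    simp only
    abel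

theorem IsHyperbolic.card_perp [Finite A] [Finite V] {e f : V} (H : h.IsHyperbolic e f) {m : ℕ}
    (hV : Nat.card V = Nat.card A ^ (2 * (m + 1))) :
    Nat.card (h.perp e f) = Nat.card A ^ (2 * m) := by
  have h1 := Nat.card_congr H.decomp
  rw [Nat.card_prod, Nat.card_prod, hV] at h1
  have h2 : 0 < Nat.card A * Nat.card A := Nat.mul_pos Nat.card_pos Nat.card_pos
  refine Nat.eq_of_mul_eq_mul_left h2 ?_
  rw [mul_assoc, ← h1]
  ring

/-- The singular vectors split along with a hyperbolic pair. -/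
theorem IsHyperbolic.mem_singular_iff (hA : TrivialModRadical A) {e f : V}
    (H : h.IsHyperbolic e f) (v : V) : v ∈ h.singular ↔
      (H.decomp v).1 ∈ Ring.jacobson A ∧ (H.decomp v).2.1 ∈ Ring.jacobson A ∧
        (H.decomp v).2.2 ∈ (h.restrict (h.perp e f)).singular := by
  obtain ⟨⟨a, b, w⟩, rfl⟩ := H.decomp.symm.surjective v
  rw [Equiv.apply_symm_apply]
  change (op a • e + op b • f + (w : V)) ∈ h.singular ↔ a ∈ _ ∧ b ∈ _ ∧ _
  obtain ⟨h1, h2⟩ := h.mem_perp.mp w.2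
  constructor
  · intro hv
    refine ⟨?_, ?_, fun w' => ?_⟩
    · have := hv f
      simp only [form_add_left, form_smul_left, H.right, H.one, form_eq_zero_comm h2] at this
      rw [← hA.star_mem_iff]
      simpa using this
    · have := hv e
      simp only [form_add_left, form_smul_left, H.left, H.neg_one, form_eq_zero_comm h1] at this
      rw [← hA.star_mem_iff]
      simpa using this
    · have := hv w'
      obtain ⟨h3, h4⟩ := h.mem_perp.mp w'.2
      rwa [form_add_left, form_add_left, form_smul_left, form_smul_left, h3, h4, mul_zero,
        mul_zero, zero_add, zero_add] at this
  · rintro ⟨ha, hb, hw⟩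
    refine add_mem (add_mem (smul_mem_singular hA ha e) (smul_mem_singular hA hb f)) fun v => ?_
    have h3 := hw (H.decomp v).2.2
    have h4 : h.form w v = h.form w (H.decomp v).2.2 := by
      conv_lhs => rw [← H.decomp.symm_apply_apply v]
      change h.form w (op _ • e + op _ • f + ((H.decomp v).2.2 : V)) = _
      simp only [map_add, form_smul_right, form_eq_zero_comm h1, form_eq_zero_comm h2]
      simp
    rw [h4]
    exact h3

theorem IsHyperbolic.card_singular_perp [Finite A] [Finite V] (hA : TrivialModRadical A)
    {e f : V} (H : h.IsHyperbolic e f) {m : ℕ}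
    (hV : Nat.card h.singular = Nat.card (Ring.jacobson A) ^ (2 * (m + 1))) :
    Nat.card (h.restrict (h.perp e f)).singular = Nat.card (Ring.jacobson A) ^ (2 * m) := by
  have h1 : Nat.card h.singular = Nat.card (Ring.jacobson A × Ring.jacobson A ×
      (h.restrict (h.perp e f)).singular) :=
    Nat.card_congr <| (H.decomp.subtypeEquiv (q := fun t => t.1 ∈ Ring.jacobson A ∧
      t.2.1 ∈ Ring.jacobson A ∧ t.2.2 ∈ (h.restrict (h.perp e f)).singular) (H.mem_singular_iff hA)).trans <|
      { toFun p := (⟨p.1.1, p.2.1⟩, ⟨p.1.2.1, p.2.2.1⟩, ⟨p.1.2.2, p.2.2.2⟩)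
        invFun p := ⟨(p.1.1, p.2.1.1, p.2.2.1), p.1.2, p.2.1.2, p.2.2.2⟩
        left_inv _ := rfl
        right_inv _ := rfl }
  rw [Nat.card_prod, Nat.card_prod, hV] at h1
  have h2 : 0 < Nat.card (Ring.jacobson A) * Nat.card (Ring.jacobson A) :=
    Nat.mul_pos Nat.card_pos Nat.card_pos
  refine Nat.eq_of_mul_eq_mul_left h2 ?_
  rw [mul_assoc, ← h1]
  ring

/-- The number of hyperbolic pairs. -/
theorem card_hyperbolic [Finite A] [Finite V] (hA : TrivialModRadical A) {F : Type w} [Field F]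
    (e : (A ⧸ Ring.jacobson A) ≃+* F) {m : ℕ}
    (hV : Nat.card V = Nat.card A ^ (2 * (m + 1)))
    (hN : Nat.card h.singular = Nat.card (Ring.jacobson A) ^ (2 * (m + 1))) :
    Nat.card {p : V × V // h.IsHyperbolic p.1 p.2} =
      Nat.card (Ring.jacobson A) ^ (4 * m + 1) * Nat.card (hermitianRadical A) ^ 2 *
        (Nat.card F ^ (2 * m + 1) * (Nat.card F ^ (2 * (m + 1)) - 1)) := by
  have : Nontrivial A := by
    by_contra hn
    rw [not_nontrivial_iff_subsingleton] at hn
    exact zero_ne_one (by rw [← map_zero e, ← map_one e]; congr 1; subsingleton)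
  have h1 : (1 : A) ∉ Ring.jacobson A := fun h1 =>
    (Ring.jacobson_lt_top A).ne ((Ideal.eq_top_iff_one _).mpr h1)
  have hcA := card_eq_card_residue_mul e
  have hcS := hA.card_jacobson
  have hS : 0 < Nat.card (skewAdjoint A) := Nat.card_pos
  have hApos : 0 < Nat.card A := Nat.card_pos
  have hcN : Nat.card {u : V // u ∉ h.singular} + Nat.card h.singular = Nat.card V := by
    rw [add_comm, ← Nat.card_sum]
    classical exact Nat.card_congr (Equiv.sumCompl (· ∈ h.singular))
  -- The first vector of a hyperbolic pair is automatically nonsingular, since it pairs to `1`,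
  -- which is not in `𝔯`.
  have hpairs : Nat.card {p : V × V // h.IsHyperbolic p.1 p.2} =
      Nat.card (Σ u : {u : {u : V // u ∉ h.singular} // h.form u.1 u.1 = 0},
        {v : {v : V // h.form u.1.1 v = 1} // h.form v.1 v.1 = 0}) :=
    Nat.card_congr
      { toFun p := ⟨⟨⟨p.1.1, fun hp => h1 (p.2.one ▸ hp p.1.2)⟩, p.2.left⟩,
          ⟨⟨p.1.2, p.2.one⟩, p.2.right⟩⟩
        invFun p := ⟨(p.1.1.1, p.2.1.1), p.1.2, p.2.2, p.2.1.2⟩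
        left_inv _ := rfl
        right_inv _ := rfl }
  have hiso := card_nonsingular (h := h) hA
  have hsnd : ∀ u : {u : {u : V // u ∉ h.singular} // h.form u.1 u.1 = 0},
      Nat.card {v : {v : V // h.form u.1.1 v = 1} // h.form v.1 v.1 = 0} =
        Nat.card (hermitianRadical A) * Nat.card F ^ (2 * m + 1) *
          Nat.card (Ring.jacobson A) ^ (2 * m) := by
    intro u
    have h2 := card_form_eq_one hA u.1.2
    rw [card_isotropic_form_eq_one hA u.2, hV] at h2
    -- The factor `|S|` is cancelled using `|A| = q|𝔯|` and `|𝔯| = |𝔪||S|`; this is where `|𝔪|`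
    -- enters.
    refine Nat.eq_of_mul_eq_mul_left (Nat.mul_pos hApos hS) ?_
    rw [mul_assoc, ← h2, show 2 * (m + 1) = 2 * m + 1 + 1 by ring, pow_succ, mul_comm]
    rw [mul_assoc]
    congr 1
    rw [hcA, mul_pow, pow_succ (Nat.card (Ring.jacobson A))]
    conv_lhs => rw [hcS]
    conv_rhs => rw [hcS]
    ring
  have := Fintype.ofFinite {u : {u : V // u ∉ h.singular} // h.form u.1 u.1 = 0}
  rw [hpairs, Nat.card_sigma, Finset.sum_congr rfl fun u _ => hsnd u, Finset.sum_const, smul_eq_mul, Finset.card_univ,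
    ← Nat.card_eq_fintype_card]
  have hiso' : Nat.card {u : {u : V // u ∉ h.singular} // h.form u.1 u.1 = 0} =
      Nat.card (hermitianRadical A) * Nat.card (Ring.jacobson A) ^ (2 * m + 1) *
        (Nat.card F ^ (2 * (m + 1)) - 1) := by
    refine Nat.eq_of_mul_eq_mul_left hS ?_
    rw [← hiso, Nat.eq_sub_of_add_eq hcN, hV, hN, hcA, mul_pow, ← Nat.sub_one_mul,
      show 2 * (m + 1) = 2 * m + 1 + 1 by ring, pow_succ (Nat.card (Ring.jacobson A)) (2 * m + 1)]
    nth_rw 2 [hcS]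
    ring
  rw [hiso']
  ring

variable (h) in
/-- A symplectic frame: two families of vectors with Gram matrix `(0, 1; -1, 0)`. -/
structure IsFrame {m : ℕ} (E F : Fin m → V) : Prop where
  left : ∀ i j, h.form (E i) (E j) = 0
  right : ∀ i j, h.form (F i) (F j) = 0
  one : ∀ i j, h.form (E i) (F j) = if i = j then 1 else 0

theorem isFrame_cons_iff {m : ℕ} {e f : V} {E F : Fin m → V} :
    h.IsFrame (Fin.cons e E : Fin (m + 1) → V) (Fin.cons f F : Fin (m + 1) → V) ↔
      h.IsHyperbolic e f ∧ (∀ i, E i ∈ h.perp e f) ∧ (∀ i, F i ∈ h.perp e f) ∧ h.IsFrame E F := by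
  constructor
  · intro H
    refine ⟨⟨H.left 0 0, H.right 0 0, by simpa using H.one 0 0⟩, fun i => ⟨?_, ?_⟩,
      fun i => ⟨?_, ?_⟩, fun i j => ?_, fun i j => ?_, fun i j => ?_⟩
    · simpa using H.left 0 i.succ
    · exact form_eq_zero_comm (by simpa using H.one i.succ 0)
    · simpa [(Fin.succ_ne_zero i).symm] using H.one 0 i.succ
    · simpa using H.right 0 i.succ
    · simpa using H.left i.succ j.succ
    · simpa using H.right i.succ j.succ
    · simpa using H.one i.succ j.succ
  · rintro ⟨H, hE, hF, H'⟩
    refine ⟨?_, ?_, ?_⟩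
    · refine Fin.cases (Fin.cases H.left fun j => ?_) fun i => Fin.cases ?_ fun j => ?_
      · exact (hE j).1
      · exact form_eq_zero_comm (hE i).1
      · exact H'.left i j
    · refine Fin.cases (Fin.cases H.right fun j => ?_) fun i => Fin.cases ?_ fun j => ?_
      · exact (hF j).2
      · exact form_eq_zero_comm (hF i).2
      · exact H'.right i j
    · refine Fin.cases (Fin.cases (by simpa using H.one) fun j => ?_)
        fun i => Fin.cases ?_ fun j => ?_
      · simpa [(Fin.succ_ne_zero j).symm] using (hF j).1
      · simpa using form_eq_zero_comm (hE i).2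
      · simpa using H'.one i j

/-- A frame is a hyperbolic pair followed by a frame of its orthogonal complement. -/
def frameSuccEquiv (m : ℕ) :
    {p : (Fin (m + 1) → V) × (Fin (m + 1) → V) // h.IsFrame p.1 p.2} ≃
      Σ p : {p : V × V // h.IsHyperbolic p.1 p.2},
        {r : (Fin m → h.perp p.1.1 p.1.2) × (Fin m → h.perp p.1.1 p.1.2) //
          (h.restrict (h.perp p.1.1 p.1.2)).IsFrame r.1 r.2} where
  toFun p :=
    have H := isFrame_cons_iff.mp (by
      rw [Fin.cons_self_tail, Fin.cons_self_tail]
      exact p.2 : h.IsFrame (Fin.cons (p.1.1 0) (Fin.tail p.1.1) : Fin (m + 1) → V)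
        (Fin.cons (p.1.2 0) (Fin.tail p.1.2) : Fin (m + 1) → V))
    ⟨⟨(p.1.1 0, p.1.2 0), H.1⟩, ⟨(fun i => ⟨Fin.tail p.1.1 i, H.2.1 i⟩,
      fun i => ⟨Fin.tail p.1.2 i, H.2.2.1 i⟩),
      ⟨H.2.2.2.left, H.2.2.2.right, H.2.2.2.one⟩⟩⟩
  invFun p := ⟨(Fin.cons p.1.1.1 fun i => (p.2.1.1 i : V), Fin.cons p.1.1.2 fun i => (p.2.1.2 i : V)),
    isFrame_cons_iff.mpr ⟨p.1.2, fun i => (p.2.1.1 i).2, fun i => (p.2.1.2 i).2,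
      ⟨p.2.2.left, p.2.2.right, p.2.2.one⟩⟩⟩
  left_inv p := Subtype.ext (Prod.ext (Fin.cons_self_tail _) (Fin.cons_self_tail _))
  right_inv p := rfl

theorem card_frames [Finite A] (hA : TrivialModRadical A) {F : Type w} [Field F]
    (e : (A ⧸ Ring.jacobson A) ≃+* F) (m : ℕ) :
    ∀ {V : Type v} [AddCommGroup V] [Module Aᵐᵒᵖ V] (h : SkewHermitianForm A V),
      Nat.card V = Nat.card A ^ (2 * m) →
      Nat.card h.singular = Nat.card (Ring.jacobson A) ^ (2 * m) →
      Nat.card {p : (Fin m → V) × (Fin m → V) // h.IsFrame p.1 p.2} =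
        Nat.card (Ring.jacobson A) ^ (2 * m ^ 2 - m) * Nat.card (hermitianRadical A) ^ (2 * m) *
          (Nat.card F ^ (m ^ 2) * ∏ i ∈ Finset.Icc 1 m, (Nat.card F ^ (2 * i) - 1)) := by
  induction m with
  | zero =>
    intro V _ _ h _ _
    rw [Nat.card_eq_one_iff_unique.mpr ⟨⟨fun _ _ => Subtype.ext (Subsingleton.elim _ _)⟩,
      ⟨(Fin.elim0, Fin.elim0), ⟨fun i => i.elim0, fun i => i.elim0, fun i => i.elim0⟩⟩⟩]
    simp
  | succ m ih =>
    intro V _ _ h hV hN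
    have : Finite V := Nat.finite_of_card_ne_zero (by rw [hV]; exact pow_ne_zero _ Nat.card_pos.ne')
    have := Fintype.ofFinite {p : V × V // h.IsHyperbolic p.1 p.2}
    rw [Nat.card_congr (frameSuccEquiv m), Nat.card_sigma, Finset.sum_congr rfl fun p _ =>
      ih (h.restrict (h.perp p.1.1 p.1.2)) (p.2.card_perp hV) (p.2.card_singular_perp hA hN),
      Finset.sum_const, smul_eq_mul, Finset.card_univ, ← Nat.card_eq_fintype_card,
      card_hyperbolic hA e hV hN, Finset.prod_Icc_succ_top (by omega)]
    -- The subtraction is in `ℕ`, so `m ≤ 2 * m ^ 2` is needed to rule out truncation.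
    have h1 : 2 * (m + 1) ^ 2 - (m + 1) = (4 * m + 1) + (2 * m ^ 2 - m) := by
      have : m ≤ 2 * m ^ 2 := by nlinarith
      zify [this, (by nlinarith : m + 1 ≤ 2 * (m + 1) ^ 2)]
      ring
    rw [h1, pow_add _ (4 * m + 1), show (m + 1) ^ 2 = (2 * m + 1) + m ^ 2 by ring,
      pow_add _ (2 * m + 1), show 2 * (m + 1) = 2 + 2 * m by ring,
      pow_add (Nat.card (hermitianRadical A))]
    ac_rfl

end SkewHermitianForm

/-! ### From frames to the unitary group. -/

namespace SkewHermitianForm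

open MulOpposite

variable {A : Type u} [Ring A] [StarRing A] {V : Type v} [AddCommGroup V] [Module Aᵐᵒᵖ V]
  {h : SkewHermitianForm A V}

/-- If the coordinate functions are represented by vectors, the singular vectors are those with
coordinates in the radical. -/
theorem card_singular_of_coordinates (hA : TrivialModRadical A) {ι : Type*} [Fintype ι]
    (c : V ≃ (ι → A)) (hc : ∀ i, ∃ w, ∀ v, h.form w v = c v i)
    (hr : ∀ v, (∀ i, c v i ∈ Ring.jacobson A) → v ∈ h.singular) :
    Nat.card h.singular = Nat.card (Ring.jacobson A) ^ Fintype.card ι := by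
  have key : ∀ v, v ∈ h.singular ↔ ∀ i, c v i ∈ Ring.jacobson A := by
    refine fun v => ⟨fun hv i => ?_, hr v⟩
    obtain ⟨w, hw⟩ := hc i
    rw [← hw, h.skew v w]
    exact neg_mem (hA.star_mem (hv w))
  rw [Nat.card_congr ((c.subtypeEquiv (q := fun x => ∀ i, x i ∈ Ring.jacobson A) key).trans
    (Equiv.subtypePiEquivPi (p := fun _ (a : A) => a ∈ Ring.jacobson A))), Nat.card_pi, Finset.prod_const,
    Finset.card_univ]

theorem card_singular_of_basis (hA : TrivialModRadical A) {ι : Type*} [Fintype ι]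
    (b : Module.Basis ι Aᵐᵒᵖ V) (hh : h.Nondegenerate) :
    Nat.card h.singular = Nat.card (Ring.jacobson A) ^ Fintype.card ι := by
  refine card_singular_of_coordinates hA
    (b.equivFun.toEquiv.trans (Equiv.piCongrRight fun _ => opEquiv.symm)) (fun i => ?_) ?_
  · obtain ⟨w, hw⟩ := hh.2
      { toFun := fun v => unop (b.repr v i)
        map_add' := fun x y => by simp
        map_smul' := fun x y => by simp }
    exact ⟨w, fun v => by rw [hw]; rfl⟩
  · intro v hv
    rw [← b.sum_equivFun v]
    exact sum_mem fun i _ => smul_mem_singular hA (hv i) (b i)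

/-- Pairing a relation with the partner of a frame vector isolates its coefficient up to sign. -/
theorem IsFrame.linearIndependent {m : ℕ} {E F : Fin m → V} (H : h.IsFrame E F) :
    LinearIndependent Aᵐᵒᵖ (Sum.elim E F) := by
  have hFE : ∀ i j, h.form (F i) (E j) = if i = j then -1 else 0 := fun i j => by
    rw [h.skew (E j), H.one]
    split_ifs <;> simp_all
  rw [Fintype.linearIndependent_iff]
  intro g hg
  rw [Fintype.sum_sum_type] at hg
  simp only [Sum.elim_inl, Sum.elim_inr] at hg
  rintro (i | i)
  · have := congrArg (h.form (F i)) hg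
    simpa [hFE, H.right, map_sum] using this
  · have := congrArg (h.form (E i)) hg
    simpa [H.one, H.left, map_sum] using this

/-- The coordinate map `A^(2m) → V` is injective between finite sets of equal size, hence onto. -/
theorem IsFrame.span_eq_top [Finite A] {m : ℕ} {E F : Fin m → V} (H : h.IsFrame E F)
    (hV : Nat.card V = Nat.card A ^ (2 * m)) :
    Submodule.span Aᵐᵒᵖ (Set.range (Sum.elim E F)) = ⊤ := by
  have : Finite V := Nat.finite_of_card_ne_zero (by rw [hV]; exact pow_ne_zero _ Nat.card_pos.ne')
  have h1 : Function.Injective (Fintype.linearCombination Aᵐᵒᵖ (Sum.elim E F)) :=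
    H.linearIndependent.fintypeLinearCombination_injective
  have h2 := h1.bijective_of_nat_card_le (by
    rw [hV, Nat.card_fun, Nat.card_congr (opEquiv (α := A)), Nat.card_sum, Nat.card_fin, two_mul])
  rw [← Fintype.range_linearCombination, LinearMap.range_eq_top]
  exact h2.2

/-- The basis given by a frame. -/
noncomputable def IsFrame.basis [Finite A] {m : ℕ} {E F : Fin m → V} (H : h.IsFrame E F)
    (hV : Nat.card V = Nat.card A ^ (2 * m)) : Module.Basis (Fin m ⊕ Fin m) Aᵐᵒᵖ V :=
  Module.Basis.mk H.linearIndependent (H.span_eq_top hV).ge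

theorem IsFrame.basis_apply [Finite A] {m : ℕ} {E F : Fin m → V} (H : h.IsFrame E F)
    (hV : Nat.card V = Nat.card A ^ (2 * m)) (i : Fin m ⊕ Fin m) :
    H.basis hV i = Sum.elim E F i :=
  Module.Basis.mk_apply _ _ i

theorem IsFrame.form_eq {m : ℕ} {E F E' F' : Fin m → V} (H : h.IsFrame E F)
    (H' : h.IsFrame E' F') (i j : Fin m ⊕ Fin m) :
    h.form (Sum.elim E F i) (Sum.elim E F j) = h.form (Sum.elim E' F' i) (Sum.elim E' F' j) := by
  rcases i with i | i <;> rcases j with j | j <;>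
    simp only [Sum.elim_inl, Sum.elim_inr]
  · rw [H.left, H'.left]
  · rw [H.one, H'.one]
  · rw [h.skew (E j), h.skew (E' j), H.one, H'.one]
  · rw [H.right, H'.right]

/-- Linearity is available only in the second variable: extend there first, then swap arguments by
skewness and extend again. -/
theorem form_map_eq_of_basis {ι : Type*} (b : Module.Basis ι Aᵐᵒᵖ V) (g : V →ₗ[Aᵐᵒᵖ] V)
    (H : ∀ i j, h.form (g (b i)) (g (b j)) = h.form (b i) (b j)) (u v : V) :
    h.form (g u) (g v) = h.form u v := by
  have h1 : ∀ i v, h.form (g (b i)) (g v) = h.form (b i) v := fun i v =>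
    LinearMap.congr_fun (b.ext (H i) : (h.form (g (b i))).comp g = h.form (b i)) v
  have h2 : (h.form (g u)).comp g = h.form u := b.ext fun i => by
    rw [LinearMap.comp_apply, h.skew (g (b i)), h1, ← h.skew]
  exact LinearMap.congr_fun h2 v

/-- The unitary group acts simply transitively on frames. -/
theorem card_unitaryGroup [Finite A] {m : ℕ} {E F : Fin m → V} (H : h.IsFrame E F)
    (hV : Nat.card V = Nat.card A ^ (2 * m)) :
    Nat.card h.unitaryGroup =
      Nat.card {p : (Fin m → V) × (Fin m → V) // h.IsFrame p.1 p.2} := by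
  have hg : ∀ g : h.unitaryGroup, h.IsFrame (fun i => g.1 (E i)) (fun i => g.1 (F i)) := fun g =>
    ⟨fun i j => (g.2 _ _).trans (H.left i j), fun i j => (g.2 _ _).trans (H.right i j),
      fun i j => (g.2 _ _).trans (H.one i j)⟩
  refine Nat.card_congr (Equiv.ofBijective
    (fun g => ⟨(fun i => g.1 (E i), fun i => g.1 (F i)), hg g⟩) ⟨fun g g' hgg => ?_, ?_⟩)
  · have h1 := congrArg Subtype.val hgg
    refine Subtype.ext (LinearEquiv.toLinearMap_injective ((H.basis hV).ext ?_))
    rintro (i | i)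
    · simpa [H.basis_apply hV] using congrFun (congrArg Prod.fst h1) i
    · simpa [H.basis_apply hV] using congrFun (congrArg Prod.snd h1) i
  · rintro ⟨⟨E', F'⟩, H'⟩
    have h1 : ∀ i, (H.basis hV).equiv (H'.basis hV) (Equiv.refl _) (Sum.elim E F i) =
        Sum.elim E' F' i := fun i => by
      rw [← H.basis_apply hV, Module.Basis.equiv_apply, H'.basis_apply hV]
      rfl
    refine ⟨⟨(H.basis hV).equiv (H'.basis hV) (Equiv.refl _), ?_⟩, Subtype.ext (Prod.ext ?_ ?_)⟩
    · refine form_map_eq_of_basis (H.basis hV) (LinearEquiv.toLinearMap _) fun i j => ?_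
      rw [LinearEquiv.coe_coe, H.basis_apply hV, H.basis_apply hV, h1, h1]
      exact H'.form_eq H i j
    · exact funext fun i => h1 (Sum.inl i)
    · exact funext fun i => h1 (Sum.inr i)

/-- The skew-hermitian form on `A^{2m}` with Gram matrix `standardSkew A m`. -/
def standard (A : Type u) [Ring A] [StarRing A] (m : ℕ) :
    SkewHermitianForm A (Fin m ⊕ Fin m → A) where
  form x :=
    { toFun := fun y => star x ⬝ᵥ standardSkew A m *ᵥ y
      map_add' := fun y z => by rw [mulVec_add, dotProduct_add]
      map_smul' := fun a y => by
        rw [RingHom.id_apply, mulVec_smul, dotProduct_smul] }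
  skew x y := by
    have hJ : (standardSkew A m)ᴴ = -standardSkew A m := by
      simp [standardSkew, fromBlocks_conjTranspose, fromBlocks_neg]
    change star y ⬝ᵥ standardSkew A m *ᵥ x = -star (star x ⬝ᵥ standardSkew A m *ᵥ y)
    rw [← star_dotProduct, star_mulVec, hJ, vecMul_neg, neg_dotProduct, neg_neg,
      dotProduct_mulVec]

theorem standard_form_apply (A : Type u) [Ring A] [StarRing A] (m : ℕ)
    (x y : Fin m ⊕ Fin m → A) :
    (standard A m).form x y = star x ⬝ᵥ standardSkew A m *ᵥ y := rfl

end SkewHermitianForm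

/-! ### The standard form and the matrix group. -/

namespace SkewHermitianForm

variable {A : Type u} [Ring A] [StarRing A]

theorem standard_form_eq_sum (m : ℕ) (x y : Fin m ⊕ Fin m → A) :
    (standard A m).form x y = ∑ i, star (x (Sum.inl i)) * y (Sum.inr i) -
      ∑ i, star (x (Sum.inr i)) * y (Sum.inl i) := by
  rw [standard_form_apply, standardSkew, fromBlocks_mulVec, dotProduct, Fintype.sum_sum_type]
  simp [sub_eq_add_neg, neg_mulVec]

theorem card_singular_standard (hA : TrivialModRadical A) (m : ℕ) :
    Nat.card (standard A m).singular = Nat.card (Ring.jacobson A) ^ (2 * m) := by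
  have h1 := card_singular_of_coordinates (h := standard A m) hA (Equiv.refl _) ?_ ?_
  · rw [h1, Fintype.card_sum, Fintype.card_fin, two_mul]
  · rintro (i | i)
    -- The sign compensates the `-1` block of `J`.
    · refine ⟨Pi.single (Sum.inr i) (-1), fun v => ?_⟩
      rw [standard_form_eq_sum]
      simp [Pi.single_apply, apply_ite star]
    · refine ⟨Pi.single (Sum.inl i) 1, fun v => ?_⟩
      rw [standard_form_eq_sum]
      simp [Pi.single_apply, apply_ite star]
  · intro v hv w
    rw [standard_form_eq_sum]
    exact sub_mem (sum_mem fun i _ => Ideal.mul_mem_right _ _ (hA.star_mem (hv _)))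
      (sum_mem fun i _ => Ideal.mul_mem_right _ _ (hA.star_mem (hv _)))

omit [Ring A] [StarRing A] in
theorem card_standard (m : ℕ) :
    Nat.card (Fin m ⊕ Fin m → A) = Nat.card A ^ (2 * m) := by
  rw [Nat.card_fun, Nat.card_sum, Nat.card_fin, two_mul]

theorem isFrame_standard_iff {m : ℕ} (X : Matrix (Fin m ⊕ Fin m) (Fin m ⊕ Fin m) A) :
    (standard A m).IsFrame (fun i k => X k (Sum.inl i)) (fun i k => X k (Sum.inr i)) ↔
      Xᴴ * standardSkew A m * X = standardSkew A m := by
  have key : ∀ i j, (standard A m).form (fun k => X k i) (fun k => X k j) =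
      (Xᴴ * standardSkew A m * X) i j := fun i j => by
    rw [Matrix.mul_assoc]
    rfl
  constructor
  · intro H
    ext (i | i) (j | j) <;> rw [← key]
    · simpa [standardSkew] using H.left i j
    · simpa [standardSkew, Matrix.one_apply] using H.one i j
    · rw [skew, H.one]
      simp only [standardSkew, fromBlocks_apply₂₁, Matrix.neg_apply, Matrix.one_apply, eq_comm]
      split_ifs <;> simp
    · simpa [standardSkew] using H.right i j
  · intro H
    refine ⟨fun i j => ?_, fun i j => ?_, fun i j => ?_⟩
    · rw [key, H]; simp [standardSkew]
    · rw [key, H]; simp [standardSkew]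
    · rw [key, H]; simp [standardSkew, Matrix.one_apply]

/-- Since `J² = -1`, the matrix `-J X^* J` is a left inverse of `X`, and the matrix ring is finite.
-/
theorem isUnit_of_conjTranspose_mul_standardSkew [Finite A] {m : ℕ}
    {X : Matrix (Fin m ⊕ Fin m) (Fin m ⊕ Fin m) A}
    (H : Xᴴ * standardSkew A m * X = standardSkew A m) : IsUnit X := by
  refine .of_mul_eq_one_right (-standardSkew A m * Xᴴ * standardSkew A m) ?_
  rw [Matrix.mul_assoc, Matrix.mul_assoc, ← Matrix.mul_assoc Xᴴ, H, standardSkew, neg_mul,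
    fromBlocks_multiply, fromBlocks_neg]
  simp

theorem card_unitaryMatrixGroup_eq_card_matrix [Finite A] (m : ℕ) :
    Nat.card (unitaryMatrixGroup A m) =
      Nat.card {X : Matrix (Fin m ⊕ Fin m) (Fin m ⊕ Fin m) A //
        Xᴴ * standardSkew A m * X = standardSkew A m} :=
  Nat.card_congr (Equiv.ofBijective (fun X => ⟨X.1.val, X.2⟩)
    ⟨fun _ _ H => Subtype.ext (Units.ext (congrArg Subtype.val H)), fun X =>
      ⟨⟨(isUnit_of_conjTranspose_mul_standardSkew X.2).unit, X.2⟩, rfl⟩⟩)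

theorem card_unitaryMatrixGroup_eq_card_frames [Finite A] (m : ℕ) :
    Nat.card (unitaryMatrixGroup A m) =
      Nat.card {p : (Fin m → Fin m ⊕ Fin m → A) × (Fin m → Fin m ⊕ Fin m → A) //
        (standard A m).IsFrame p.1 p.2} := by
  rw [card_unitaryMatrixGroup_eq_card_matrix]
  exact Nat.card_congr
    { toFun X := ⟨(fun i k => X.1 k (Sum.inl i), fun i k => X.1 k (Sum.inr i)),
        (isFrame_standard_iff X.1).mpr X.2⟩
      invFun p := ⟨Matrix.of fun k => Sum.elim (fun i => p.1.1 i k) (fun i => p.1.2 i k),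
        (isFrame_standard_iff _).mp p.2⟩
      left_inv X := by
        refine Subtype.ext ?_
        ext k (i | i) <;> rfl
      right_inv p := rfl }

theorem card_unitaryMatrixGroup [Finite A] (hA : TrivialModRadical A) {F : Type w} [Field F]
    (e : (A ⧸ Ring.jacobson A) ≃+* F) (m : ℕ) :
    Nat.card (unitaryMatrixGroup A m) =
      Nat.card (Ring.jacobson A) ^ (2 * m ^ 2 - m) * Nat.card (hermitianRadical A) ^ (2 * m) *
        (Nat.card F ^ (m ^ 2) * ∏ i ∈ Finset.Icc 1 m, (Nat.card F ^ (2 * i) - 1)) := by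
  rw [card_unitaryMatrixGroup_eq_card_frames]
  exact card_frames hA e m _ (card_standard m) (card_singular_standard hA m)

end SkewHermitianForm

/-! ### The symplectic order and the final assembly. -/

/-- This is the matrix formula for `A = F` with trivial involution: there `𝔯 = 0`, so both radical
factors are `1`. -/
theorem card_symplecticGroup {F : Type w} [Field F] [Finite F] (hchar : Odd (ringChar F)) (m : ℕ) :
    Nat.card (Matrix.symplecticGroup (Fin m) F) =
      Nat.card F ^ (m ^ 2) * ∏ i ∈ Finset.Icc 1 m, (Nat.card F ^ (2 * i) - 1) := by
  let _ : StarRing F := starRingOfComm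
  have hJ : Ring.jacobson F = ⊥ := IsSemisimpleRing.jacobson_eq_bot F
  have e : (F ⧸ Ring.jacobson F) ≃+* F :=
    (Ideal.quotEquivOfEq hJ).trans (RingEquiv.quotientBot F)
  have hA : TrivialModRadical F :=
    ⟨isUnit_two_of_odd_ringChar e hchar, isUnit_of_notMem_jacobson e, fun a => by
      rw [show star a = a from rfl, sub_self]
      exact zero_mem _⟩
  have h1 : Nat.card (Ring.jacobson F) = 1 := by
    rw [hJ]
    simp
  have h2 : Nat.card (hermitianRadical F) = 1 := by
    have := hA.card_jacobson
    rw [h1, eq_comm, mul_eq_one] at this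
    exact this.1
  have h3 := SkewHermitianForm.card_unitaryMatrixGroup hA e m
  rw [h1, h2, one_pow, one_pow, one_mul, one_mul,
    SkewHermitianForm.card_unitaryMatrixGroup_eq_card_matrix] at h3
  rw [← h3]
  refine Nat.card_congr (Equiv.subtypeEquivRight fun X => ?_)
  have h4 : standardSkew F m = -Matrix.J (Fin m) F := by
    simp [standardSkew, Matrix.J, fromBlocks_neg]
  have h5 : Xᴴ = Xᵀ := rfl
  rw [SymplecticGroup.mem_iff', h4, h5, mul_neg, neg_mul, neg_inj]

theorem mainTheorem1 {A : Type u} [Ring A] [Finite A] [IsLocalRing A] [StarRing A]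
    (hstar : ∀ a : A, a - star a ∈ Ring.jacobson A)
    {F : Type w} [Field F] (e : (A ⧸ Ring.jacobson A) ≃+* F) (hchar : Odd (ringChar F))
    (q : ℕ) (hq : Nat.card F = q) (m : ℕ) :
    Nat.card (unitaryMatrixGroup A m) =
        Nat.card (Ring.jacobson A) ^ (2 * m ^ 2 - m) * Nat.card (hermitianRadical A) ^ (2 * m) *
          (q ^ (m ^ 2) * ∏ i ∈ Finset.Icc 1 m, (q ^ (2 * i) - 1)) ∧
    (∀ (V : Type v) [AddCommGroup V] [Module Aᵐᵒᵖ V] [Module.Free Aᵐᵒᵖ V] [Module.Finite Aᵐᵒᵖ V]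
        (h : SkewHermitianForm A V), h.Nondegenerate → Module.finrank Aᵐᵒᵖ V = 2 * m →
      Nat.card h.unitaryGroup =
        Nat.card (Ring.jacobson A) ^ (2 * m ^ 2 - m) * Nat.card (hermitianRadical A) ^ (2 * m) *
          (q ^ (m ^ 2) * ∏ i ∈ Finset.Icc 1 m, (q ^ (2 * i) - 1))) ∧
    Nat.card (Matrix.symplecticGroup (Fin m) F) =
      q ^ (m ^ 2) * ∏ i ∈ Finset.Icc 1 m, (q ^ (2 * i) - 1) := by
  subst hq
  have hA : TrivialModRadical A :=
    ⟨isUnit_two_of_odd_ringChar e hchar, isUnit_of_notMem_jacobson e, hstar⟩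
  have : Finite (A ⧸ Ring.jacobson A) := .of_surjective _ Ideal.Quotient.mk_surjective
  have hF : Finite F := .of_equiv _ e.toEquiv
  refine ⟨SkewHermitianForm.card_unitaryMatrixGroup hA e m, ?_, card_symplecticGroup hchar m⟩
  intro V _ _ _ _ h hh hrank
  have : Finite Aᵐᵒᵖ := .of_equiv _ MulOpposite.opEquiv
  have b := Module.finBasisOfFinrankEq Aᵐᵒᵖ V hrank
  have hV : Nat.card V = Nat.card A ^ (2 * m) := by
    rw [Nat.card_congr b.equivFun.toEquiv, Nat.card_fun, Nat.card_fin,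
      Nat.card_congr (MulOpposite.opEquiv (α := A))]
  have hN := SkewHermitianForm.card_singular_of_basis hA b hh
  rw [Fintype.card_fin] at hN
  have hcard := SkewHermitianForm.card_frames hA e m h hV hN
  -- Every factor of the count is nonzero because `q > 1`; hence some frame exists, on which the
  -- group acts simply transitively.
  have hpos : Nat.card {p : (Fin m → V) × (Fin m → V) // h.IsFrame p.1 p.2} ≠ 0 := by
    have h1 : ∀ i ∈ Finset.Icc 1 m, Nat.card F ^ (2 * i) - 1 ≠ 0 := fun i hi => by
      have h2 : 1 < Nat.card F ^ (2 * i) := Nat.one_lt_pow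
        (by have := (Finset.mem_Icc.mp hi).1; omega) Finite.one_lt_card
      omega
    rw [hcard]
    exact mul_ne_zero (mul_ne_zero (pow_ne_zero _ Nat.card_pos.ne')
      (pow_ne_zero _ Nat.card_pos.ne'))
      (mul_ne_zero (pow_ne_zero _ Nat.card_pos.ne') (Finset.prod_ne_zero_iff.mpr h1))
  obtain ⟨⟨p, hp⟩⟩ := (Nat.card_ne_zero.mp hpos).1
  rw [SkewHermitianForm.card_unitaryGroup hp hV, hcard]
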